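/- Let $\mathbb{D}=\{z\in\mathbb{C}:|z|<1\}$. For a harmonic mapping $f:\mathbb{D}\to\mathbb{C}$ write $J_f=|f_z|^2-|f_{\overline z}|^2$ for its Jacobian. Call $f$ sense-preserving if $J_f>0$ in $\mathbb{D}$, and uniformly locally univalent (ULU) if there is a constant $\rho>0$ such that, for every $a\in\mathbb{D}$, $f$ is injective on the hyperbolic disk $\left\{z\in\mathbb{D}:\left|\frac{z-a}{1-\overline{a}z}\right|<\tanh\rho\right\}$. Let $\mathcal{B}^*_H(1)$ be the class of harmonic mappings $f$ in $\mathbb{D}$ with $\sup_{z\in\mathbb{D}}(1-|z|^2)\sqrt{|J_f(z)|}<\infty$. Theorem. Let $H$ and $G$ be analytic in $\mathbb{D}$ and suppose that $F=H+\overline{G}$ is sense-preserving and ULU in $\mathbb{D}$. Let $\varepsilon\in\overline{\mathbb{D}}$. Then $H'+\varepsilon G'$ has an analytic logarithm in $\mathbb{D}$. Moreover, let $h_\varepsilon=\log(H'+\varepsilon G')$ be any such logarithm, that is, any analytic function in $\mathbb{D}$ with $e^{h_\varepsilon}=H'+\varepsilon G'$, and let $g_\varepsilon$ be any analytic function in $\mathbb{D}$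 whose dilatation relative to $h_\varepsilon$ is bounded, that is, $g_\varepsilon'=\omega h_\varepsilon'$ in $\mathbb{D}$ for some bounded function $\omega:\mathbb{D}\to\mathbb{C}$. Then the harmonic mapping $f_\varepsilon=h_\varepsilon+\overline{g_\varepsilon}$ belongs to $\mathcal{B}^*_H(1)$. -/

import Mathlib

open Complex Metric
open scoped ComplexConjugate

namespace HarmonicBloch

/-- The Wirtinger derivative `f_z = (f_x - i f_y) / 2` of a (real differentiable) map. -/
noncomputable def dz (f : ℂ → ℂ) (z : ℂ) : ℂ :=
  (fderiv ℝ f z 1 - I * fderiv ℝ f z I) / 2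

/-- The Wirtinger derivative `f_{z̄} = (f_x + i f_y) / 2` of a (real differentiable) map. -/
noncomputable def dzbar (f : ℂ → ℂ) (z : ℂ) : ℂ :=
  (fderiv ℝ f z 1 + I * fderiv ℝ f z I) / 2

/-- The Jacobian `J_f = |f_z|² - |f_{z̄}|²`. -/
noncomputable def jacobian (f : ℂ → ℂ) (z : ℂ) : ℝ :=
  ‖dz f z‖ ^ 2 - ‖dzbar f z‖ ^ 2

/-- A complex-valued harmonic mapping of the open unit disk. -/
def IsHarmonicMapping (f : ℂ → ℂ) : Prop :=
  InnerProductSpace.HarmonicOnNhd f (ball (0 : ℂ) 1)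

/-- A harmonic mapping of the disk is (locally univalent and) sense-preserving when its
Jacobian is positive throughout the disk. -/
def SensePreserving (f : ℂ → ℂ) : Prop :=
  ∀ z ∈ ball (0 : ℂ) 1, 0 < jacobian f z

/-- The hyperbolic disk `D_h(a, ρ)` with center `a` and radius `ρ` in the unit disk. -/
def hyperbolicDisk (a : ℂ) (ρ : ℝ) : Set ℂ :=
  {z | z ∈ ball (0 : ℂ) 1 ∧ ‖(z - a) / (1 - conj a * z)‖ < Real.tanh ρ}

/-- Uniform local univalence: for some `ρ > 0`, the harmonic mapping `f` is injective on every
hyperbolic disk of radius `ρ`. -/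
def IsULU (f : ℂ → ℂ) : Prop :=
  IsHarmonicMapping f ∧
    ∃ ρ : ℝ, 0 < ρ ∧ ∀ a ∈ ball (0 : ℂ) 1, Set.InjOn f (hyperbolicDisk a ρ)

/-- The class `𝓑*_H(ν)` of harmonic `ν`-Bloch-type mappings: harmonic mappings `f` of the disk
with `sup_{z ∈ 𝔻} (1 - |z|²)^ν √|J_f(z)| < ∞`. -/
def blochType (ν : ℝ) : Set (ℂ → ℂ) :=
  {f | IsHarmonicMapping f ∧
    BddAbove ((fun z : ℂ => (1 - ‖z‖ ^ 2) ^ ν * √|jacobian f z|) '' ball (0 : ℂ) 1)}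

end HarmonicBloch

open Filter Topology Set
open scoped NNReal

/-!
Write `F = H + conj G` with dilatation `ω = G' / H'`. The heart of the matter is that the
pre-Schwarzian `P = H'' / H'` satisfies `(1 - |z|) |P z| ≤ C`. If it did not, Hofer's lemma would
provide disks of radius `r` about points `a` on which `F` is injective, `|P| ≤ 2 |P a|`, and
`r |P a|` is as large as we please. Rescaling `z ↦ a + z / P a` turns this into `H' 0 = P 0 = 1`
and `|P| ≤ 2` on a huge disk (radius `10 ^ 9` is ample). By the Schwarz lemma `P` is then close to
`1` on `ball 0 8`, so `H` is close to `exp` up to an additive constant, while `ω` is nearly a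
constant `c`. Undoing the real-linear map `w ↦ w + conj (c w)`, we see that `F` becomes a small
Lipschitz perturbation of `exp`, which cannot be injective because `exp` takes the same value at
`0` and at `2πi`.

Since `H' + ε G' = H' (1 + ε ω)`, its logarithmic derivative differs from `P` by
`ε ω' / (1 + ε ω)`. The Borel–Carathéodory inequality gives `|ω'| ≤ 4 (1 - |ω|) / (1 - |z|)`, and
`|1 + ε ω| ≥ 1 - |ω|`, so the factor `1 - |ω|` cancels. Hence `(1 - |z|) |h_ε'|` is bounded, and
the Jacobian of `f_ε` is at most `(1 + sup |ω_ε|)² |h_ε'|²`, where `g_ε' = ω_ε h_ε'`.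
-/

namespace HarmonicBloch

lemma fderiv_add_conj_apply {h g : ℂ → ℂ} {z : ℂ} (hh : DifferentiableAt ℂ h z)
    (hg : DifferentiableAt ℂ g z) (v : ℂ) :
    fderiv ℝ (fun z => h z + conj (g z)) z v = v * deriv h z + conj (v * deriv g z) := by
  have hh' := hh.hasDerivAt.hasFDerivAt.restrictScalars ℝ
  have hg' := hg.hasDerivAt.hasFDerivAt.restrictScalars ℝ
  have := (hh'.add ((conjCLE : ℂ →L[ℝ] ℂ).hasFDerivAt.comp z hg')).fderiv
  exact (DFunLike.congr_fun this v).trans (by simp)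

lemma dz_add_conj {h g : ℂ → ℂ} {z : ℂ} (hh : DifferentiableAt ℂ h z)
    (hg : DifferentiableAt ℂ g z) : dz (fun z => h z + conj (g z)) z = deriv h z := by
  simp only [dz, fderiv_add_conj_apply hh hg, map_mul, conj_I, map_one]
  linear_combination (-deriv h z / 2 + conj (deriv g z) / 2) * I_sq

lemma dzbar_add_conj {h g : ℂ → ℂ} {z : ℂ} (hh : DifferentiableAt ℂ h z)
    (hg : DifferentiableAt ℂ g z) : dzbar (fun z => h z + conj (g z)) z = conj (deriv g z) := by
  simp only [dzbar, fderiv_add_conj_apply hh hg, map_mul, conj_I, map_one]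
  linear_combination (deriv h z / 2 - conj (deriv g z) / 2) * I_sq

lemma jacobian_add_conj {h g : ℂ → ℂ} {z : ℂ} (hh : DifferentiableAt ℂ h z)
    (hg : DifferentiableAt ℂ g z) :
    jacobian (fun z => h z + conj (g z)) z = ‖deriv h z‖ ^ 2 - ‖deriv g z‖ ^ 2 := by
  rw [jacobian, dz_add_conj hh hg, dzbar_add_conj hh hg, RCLike.norm_conj]

lemma isHarmonicMapping_add_conj {h g : ℂ → ℂ} (hh : AnalyticOnNhd ℂ h (ball 0 1))
    (hg : AnalyticOnNhd ℂ g (ball 0 1)) : IsHarmonicMapping (fun z => h z + conj (g z)) :=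
  fun z hz => (hh z hz).harmonicAt.add (hg z hz).harmonicAt_conj

lemma SensePreserving.norm_deriv_lt {F H G : ℂ → ℂ} (hF : SensePreserving F)
    (hH : DifferentiableOn ℂ H (ball 0 1)) (hG : DifferentiableOn ℂ G (ball 0 1))
    (hFHG : EqOn F (fun z => H z + conj (G z)) (ball 0 1)) {z : ℂ} (hz : z ∈ ball 0 1) :
    ‖deriv G z‖ < ‖deriv H z‖ := by
  have hnhds : ball (0 : ℂ) 1 ∈ 𝓝 z := isOpen_ball.mem_nhds hz
  have hfderiv := (hFHG.eventuallyEq_of_mem hnhds).fderiv_eq (𝕜 := ℝ)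
  have hpos := hF z hz
  rw [jacobian, dz, dzbar, hfderiv, ← dz, ← dzbar, ← jacobian,
    jacobian_add_conj (hH.differentiableAt hnhds) (hG.differentiableAt hnhds)] at hpos
  exact lt_of_pow_lt_pow_left₀ 2 (norm_nonneg _) (by linarith)

lemma logDeriv_exp_comp {ℓ : ℂ → ℂ} {z : ℂ} (hℓ : DifferentiableAt ℂ ℓ z) :
    logDeriv (exp ∘ ℓ) z = deriv ℓ z := by
  rw [logDeriv_comp differentiableAt_exp hℓ, logDeriv_exp, Pi.one_apply, one_mul]

lemma exists_analyticOnNhd_exp_eq {F : ℂ → ℂ} {c : ℂ} {r : ℝ}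
    (hF : DifferentiableOn ℂ F (ball c r)) (hF0 : ∀ z ∈ ball c r, F z ≠ 0) :
    ∃ ℓ : ℂ → ℂ, AnalyticOnNhd ℂ ℓ (ball c r) ∧ ∀ z ∈ ball c r, exp (ℓ z) = F z := by
  obtain ⟨L, hL⟩ := ((hF.deriv isOpen_ball).div hF hF0).isExactOn_ball
  have hLd : DifferentiableOn ℂ L (ball c r) := fun z hz =>
    (hL z hz).differentiableAt.differentiableWithinAt
  have hlog : EqOn (logDeriv F) (logDeriv (exp ∘ L)) (ball c r) := fun z hz => by
    rw [logDeriv_exp_comp (hL z hz).differentiableAt, (hL z hz).deriv, logDeriv]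
  obtain ⟨a, ha, hFa⟩ := (logDeriv_eqOn_iff hF hLd.cexp isOpen_ball
    (convex_ball c r).isPreconnected (fun _ _ => exp_ne_zero _) hF0).1 hlog
  refine ⟨fun z => log a + L z, (hLd.const_add _).analyticOnNhd isOpen_ball, fun z hz => ?_⟩
  rw [hFa hz, exp_add, exp_log ha]
  rfl

lemma deriv_eq_logDeriv_of_exp_eq {h F : ℂ → ℂ} {s : Set ℂ} (hs : IsOpen s)
    (hh : DifferentiableOn ℂ h s) (hexp : ∀ z ∈ s, exp (h z) = F z) {z : ℂ} (hz : z ∈ s) :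
    deriv h z = logDeriv F z := by
  have hnhds : s ∈ 𝓝 z := hs.mem_nhds hz
  have hF : exp ∘ h =ᶠ[𝓝 z] F := eventually_of_mem hnhds hexp
  rw [← (logDeriv_congr_nhds hF).eq_of_nhds, logDeriv_exp_comp (hh.differentiableAt hnhds)]

lemma exists_exp_eq_norm_sub_le_of_norm_logDeriv_le_two {F : ℂ → ℂ} {R : ℝ}
    (hF : DifferentiableOn ℂ F (ball 0 R))
    (hF0 : ∀ z ∈ ball 0 R, F z ≠ 0) (h0 : F 0 = 1) (h1 : logDeriv F 0 = 1)
    (h2 : ∀ z ∈ ball 0 R, ‖logDeriv F z‖ ≤ 2) {z : ℂ} (hz : z ∈ ball 0 R) :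
    ∃ w, exp w = F z ∧ ‖w - z‖ ≤ 3 * ‖z‖ ^ 2 / R := by
  obtain ⟨ℓ, hℓ, hexp⟩ := exists_analyticOnNhd_exp_eq hF hF0
  have hR : 0 < R := pos_of_mem_ball hz
  have hsub : closedBall (0 : ℂ) ‖z‖ ⊆ ball 0 R := closedBall_subset_ball (mem_ball_zero_iff.1 hz)
  have hlog : DifferentiableOn ℂ (logDeriv F) (ball 0 R) := (hF.deriv isOpen_ball).div hF hF0
  have hschwarz : ∀ x ∈ closedBall (0 : ℂ) ‖z‖, ‖deriv ℓ x - 1‖ ≤ 3 / R * ‖z‖ := fun x hx => by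
    have hmaps : MapsTo (logDeriv F) (ball 0 R) (closedBall (logDeriv F 0) 3) := fun y hy => by
      rw [mem_closedBall, dist_eq_norm, h1]
      linarith [norm_sub_le (logDeriv F y) 1, h2 y hy, norm_one (α := ℂ)]
    have := dist_le_div_mul_dist_of_mapsTo_ball hlog hmaps (hsub hx)
    rw [dist_eq_norm, h1, ← deriv_eq_logDeriv_of_exp_eq isOpen_ball hℓ.differentiableOn hexp
      (hsub hx)] at this
    exact this.trans (by gcongr; exact hx)
  have hderiv : ∀ x ∈ closedBall (0 : ℂ) ‖z‖,
      HasDerivWithinAt (fun x => ℓ x - x) (deriv ℓ x - 1) (closedBall 0 ‖z‖) x := fun x hx =>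
    ((hℓ x (hsub hx)).differentiableAt.hasDerivAt.sub (hasDerivAt_id x)).hasDerivWithinAt
  have hmean := (convex_closedBall 0 ‖z‖).norm_image_sub_le_of_norm_hasDerivWithin_le hderiv
    hschwarz (mem_closedBall_self (norm_nonneg z)) (by simp : z ∈ closedBall 0 ‖z‖)
  refine ⟨ℓ z - ℓ 0, ?_, ?_⟩
  · rw [exp_sub, hexp z hz, hexp 0 (mem_ball_self hR), h0, div_one]
  · calc ‖ℓ z - ℓ 0 - z‖ = ‖ℓ z - z - (ℓ 0 - 0)‖ := by congr 1; ring
      _ ≤ 3 / R * ‖z‖ * ‖z - 0‖ := hmean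
      _ = 3 * ‖z‖ ^ 2 / R := by rw [sub_zero]; ring

lemma exp_approximatesLinearOn {r : ℝ≥0} (hr : r ≤ 1) :
    ApproximatesLinearOn exp (ContinuousLinearEquiv.refl ℂ ℂ : ℂ →L[ℂ] ℂ)
      (closedBall (2 * Real.pi * I) r) (2 * r) := by
  refine LipschitzOnWith.approximatesLinearOn <|
    (convex_closedBall _ (r : ℝ)).lipschitzOnWith_of_nnnorm_deriv_le (fun z _ => by simp)
      fun z hz => ?_
  have hderiv : deriv (exp - ⇑(ContinuousLinearEquiv.refl ℂ ℂ : ℂ →L[ℂ] ℂ)) z =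
      exp (z - 2 * Real.pi * I) - 1 := by
    rw [exp_sub, exp_two_pi_mul_I, div_one]
    exact ((hasDerivAt_exp z).sub (hasDerivAt_id z)).deriv
  have hz' : ‖z - 2 * Real.pi * I‖ ≤ r := by simpa [dist_eq_norm] using hz
  rw [hderiv, ← NNReal.coe_le_coe, coe_nnnorm]
  calc ‖exp (z - 2 * Real.pi * I) - 1‖ ≤ 2 * ‖z - 2 * Real.pi * I‖ :=
        norm_exp_sub_one_le (hz'.trans (by exact_mod_cast hr))
    _ ≤ (2 * r : ℝ≥0) := by push_cast; gcongr

lemma closedBall_subset_image_of_lipschitzOnWith_sub_exp {k : ℂ → ℂ} {s : Set ℂ}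
    (hk : LipschitzOnWith (1 / 100) (fun z => k z - exp z) s)
    (hs : closedBall (2 * Real.pi * I) (1 / 8) ⊆ s) :
    closedBall (k (2 * Real.pi * I)) (9 / 100) ⊆ k '' closedBall (2 * Real.pi * I) (1 / 8) := by
  have hexp := exp_approximatesLinearOn (r := 1 / 8) (by rw [← NNReal.coe_le_coe]; norm_num)
  rw [show ((1 / 8 : ℝ≥0) : ℝ) = 1 / 8 by norm_num] at hexp
  have happrox : ApproximatesLinearOn k (ContinuousLinearEquiv.refl ℂ ℂ : ℂ →L[ℂ] ℂ)
      (closedBall (2 * Real.pi * I) (1 / 8)) (1 / 100 + 2 * (1 / 8)) := by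
    intro x hx y hy
    have := ((hk.mono hs).add hexp.lipschitzOnWith).norm_sub_le hx hy
    simp only [Pi.sub_apply, sub_add_sub_cancel] at this
    rwa [sub_sub_sub_comm, ← map_sub] at this
  refine subset_trans (closedBall_subset_closedBall ?_) <|
    happrox.surjOn_closedBall_of_nonlinearRightInverse
      (ContinuousLinearEquiv.refl ℂ ℂ).toNonlinearRightInverse (by norm_num) subset_rfl
  have hnorm : (ContinuousLinearEquiv.refl ℂ ℂ).toNonlinearRightInverse.nnnorm = 1 :=
    ContinuousLinearMap.nnnorm_id (𝕜 := ℂ) (E := ℂ)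
  rw [hnorm]
  norm_num

lemma not_injOn_of_lipschitzOnWith_sub_exp {k : ℂ → ℂ}
    (hk : LipschitzOnWith (1 / 100) (fun z => k z - exp z) (ball 0 8)) :
    ¬ InjOn k (ball 0 8) := by
  intro hinj
  set p : ℂ := 2 * Real.pi * I
  have hp : ‖p‖ = 2 * Real.pi := by simp [p, Real.pi_pos.le]
  have hsub : closedBall p (1 / 8) ⊆ ball 0 8 := by
    refine closedBall_subset_ball' ?_
    rw [dist_zero_right, hp]
    linarith [Real.pi_lt_d2]
  have hp8 : p ∈ ball 0 8 := hsub (mem_closedBall_self (by norm_num))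
  have h08 : (0 : ℂ) ∈ ball 0 8 := mem_ball_self (by norm_num)
  have hdist : dist (k 0) (k p) ≤ 2 * Real.pi / 100 := by
    have := hk.dist_le_mul 0 h08 p hp8
    rw [exp_zero, exp_two_pi_mul_I, dist_sub_right, dist_zero_left, hp] at this
    norm_num at this ⊢
    linarith
  obtain ⟨w, hw, hkw⟩ := closedBall_subset_image_of_lipschitzOnWith_sub_exp hk hsub
    (mem_closedBall.2 (hdist.trans (by linarith [Real.pi_lt_d2])))
  have : w = 0 := hinj (hsub hw) h08 hkw
  rw [this, mem_closedBall, dist_zero_left, hp] at hw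
  linarith [Real.pi_gt_three]

lemma norm_sub_le_of_mapsTo_ball {ω : ℂ → ℂ} {c z : ℂ} {r : ℝ}
    (hω : DifferentiableOn ℂ ω (ball c r)) (hmaps : MapsTo ω (ball c r) (ball 0 1))
    (hz : ‖z - c‖ ≤ r / 2) (hr : 0 < r) :
    ‖ω z - ω c‖ ≤ 4 * (1 - ‖ω c‖) / r * ‖z - c‖ := by
  obtain ⟨u, hu, huω⟩ : ∃ u : ℂ, ‖u‖ = 1 ∧ ‖ω c‖ = u * ω c :=
    exists_norm_eq_mul_self _
  have hshift : MapsTo (fun w => c + w) (ball 0 r) (ball c r) := fun w hw => by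
    simpa [dist_eq_norm] using hw
  have hre : MapsTo (fun w => u * (ω (c + w) - ω c)) (ball 0 r) {w | w.re ≤ 1 - ‖ω c‖} :=
    fun w hw => by
      have : (u * ω (c + w)).re ≤ 1 := (re_le_norm _).trans <| by
        simpa [hu] using (mem_ball_zero_iff.1 (hmaps (hshift hw))).le
      simpa [mul_sub, ← huω] using this
  have hpos : 0 < 1 - ‖ω c‖ := sub_pos.2 (mem_ball_zero_iff.1 (hmaps (mem_ball_self hr)))
  have key := borelCaratheodory_zero hpos
    (((hω.comp (differentiableOn_id.const_add c) hshift).sub_const _).const_mul u) hre hr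
    (z := z - c) (mem_ball_zero_iff.2 (by linarith)) (by simp)
  simp only [Function.comp_apply, add_sub_cancel, norm_mul, hu, one_mul, id] at key
  calc ‖ω z - ω c‖ ≤ 2 * (1 - ‖ω c‖) * ‖z - c‖ / (r - ‖z - c‖) := key
    _ ≤ 2 * (1 - ‖ω c‖) * ‖z - c‖ / (r / 2) := by gcongr; linarith
    _ = 4 * (1 - ‖ω c‖) / r * ‖z - c‖ := by field_simp; ring

lemma norm_deriv_le_of_mapsTo_ball {ω : ℂ → ℂ} {c : ℂ} {r : ℝ}
    (hω : DifferentiableOn ℂ ω (ball c r)) (hmaps : MapsTo ω (ball c r) (ball 0 1))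
    (hr : 0 < r) : ‖deriv ω c‖ ≤ 4 * (1 - ‖ω c‖) / r := by
  have hpos : 0 < 1 - ‖ω c‖ := sub_pos.2 (mem_ball_zero_iff.1 (hmaps (mem_ball_self hr)))
  refine norm_deriv_le_of_lip' (by positivity) ?_
  filter_upwards [closedBall_mem_nhds c (half_pos hr)] with z hz
  exact norm_sub_le_of_mapsTo_ball hω hmaps (by simpa [dist_eq_norm] using hz) hr

lemma norm_exp_le_three_pow {z : ℂ} {n : ℕ} (hz : ‖z‖ ≤ n) : ‖exp z‖ ≤ 3 ^ n :=
  calc ‖exp z‖ ≤ Real.exp ‖z‖ := norm_exp_le_exp_norm z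
    _ ≤ Real.exp n := Real.exp_le_exp.2 hz
    _ = Real.exp 1 ^ n := (Real.exp_one_pow n).symm
    _ ≤ 3 ^ n := by gcongr; exact Real.exp_one_lt_three.le

lemma norm_sub_exp_le_of_norm_logDeriv_le_two {F : ℂ → ℂ}
    (hF : DifferentiableOn ℂ F (ball 0 (10 ^ 9)))
    (hF0 : ∀ z ∈ ball 0 (10 ^ 9), F z ≠ 0) (h0 : F 0 = 1) (h1 : logDeriv F 0 = 1)
    (h2 : ∀ z ∈ ball 0 (10 ^ 9), ‖logDeriv F z‖ ≤ 2) {z : ℂ} (hz : z ∈ ball 0 8) :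
    ‖F z - exp z‖ ≤ 1 / 200 := by
  have hz8 : ‖z‖ ≤ 8 := (mem_ball_zero_iff.1 hz).le
  obtain ⟨w, hw, hwz⟩ := exists_exp_eq_norm_sub_le_of_norm_logDeriv_le_two hF hF0 h0 h1 h2
    (ball_subset_ball (by norm_num) hz)
  have hwz' : ‖w - z‖ ≤ 3 * 8 ^ 2 / 10 ^ 9 := hwz.trans (by gcongr)
  calc ‖F z - exp z‖ = ‖exp z‖ * ‖exp (w - z) - 1‖ := by
        rw [← norm_mul, mul_sub, ← exp_add, add_sub_cancel, mul_one, hw]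
    _ ≤ 3 ^ 8 * (2 * (3 * 8 ^ 2 / 10 ^ 9)) := by
        gcongr
        · exact norm_exp_le_three_pow (mod_cast hz8)
        · exact (norm_exp_sub_one_le (hwz'.trans (by norm_num))).trans (by gcongr)
    _ ≤ 1 / 200 := by norm_num

/-- The harmonic mapping `h + conj g` is sense-preserving on `s`, expressed through its analytic
and co-analytic parts so that it can be used on any disk and under rescaling. -/
structure SensePreservingPairOn (h g : ℂ → ℂ) (s : Set ℂ) : Prop where
  differentiableOn_left : DifferentiableOn ℂ h s
  differentiableOn_right : DifferentiableOn ℂ g s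
  norm_deriv_lt : ∀ z ∈ s, ‖deriv g z‖ < ‖deriv h z‖

/-- The second complex dilatation `g' / h'` of the harmonic mapping `h + conj g`. -/
noncomputable def dilatation (h g : ℂ → ℂ) (z : ℂ) : ℂ :=
  deriv g z / deriv h z

/-- The pre-Schwarzian derivative `h'' / h'`. -/
noncomputable def preSchwarzian (h : ℂ → ℂ) : ℂ → ℂ :=
  logDeriv (deriv h)

namespace SensePreservingPairOn

variable {h g : ℂ → ℂ} {s : Set ℂ}

lemma mono {t : Set ℂ} (hf : SensePreservingPairOn h g s) (hts : t ⊆ s) :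
    SensePreservingPairOn h g t :=
  ⟨hf.1.mono hts, hf.2.mono hts, fun z hz => hf.3 z (hts hz)⟩

lemma deriv_ne_zero (hf : SensePreservingPairOn h g s) {z : ℂ} (hz : z ∈ s) : deriv h z ≠ 0 :=
  norm_pos_iff.1 ((norm_nonneg _).trans_lt (hf.norm_deriv_lt z hz))

lemma differentiableOn_dilatation (hf : SensePreservingPairOn h g s) (hs : IsOpen s) :
    DifferentiableOn ℂ (dilatation h g) s :=
  (hf.differentiableOn_right.deriv hs).div (hf.differentiableOn_left.deriv hs)
    fun _ hz => hf.deriv_ne_zero hz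

lemma norm_dilatation_lt_one (hf : SensePreservingPairOn h g s) {z : ℂ} (hz : z ∈ s) :
    ‖dilatation h g z‖ < 1 := by
  rw [dilatation, norm_div, div_lt_one (norm_pos_iff.2 (hf.deriv_ne_zero hz))]
  exact hf.norm_deriv_lt z hz

lemma mapsTo_dilatation (hf : SensePreservingPairOn h g s) :
    MapsTo (dilatation h g) s (ball 0 1) :=
  fun _ hz => mem_ball_zero_iff.2 (hf.norm_dilatation_lt_one hz)

lemma differentiableOn_preSchwarzian (hf : SensePreservingPairOn h g s) (hs : IsOpen s) :
    DifferentiableOn ℂ (preSchwarzian h) s :=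
  ((hf.differentiableOn_left.deriv hs).deriv hs).div (hf.differentiableOn_left.deriv hs)
    fun _ hz => hf.deriv_ne_zero hz

end SensePreservingPairOn

/-- The inverse of the real-linear map `w ↦ w + conj (c * w)`, for `‖c‖ < 1`. Post-composing with
it straightens a harmonic mapping whose dilatation is nearly the constant `c`. -/
noncomputable def shearInv (c w : ℂ) : ℂ :=
  (w - conj c * conj w) / (1 - ‖c‖ ^ 2 : ℝ)

section ShearInv

variable {c : ℂ}

lemma shearInv_add (c v w : ℂ) : shearInv c (v + w) = shearInv c v + shearInv c w := by
  simp only [shearInv, map_add]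
  ring

lemma one_sub_sq_norm_ne_zero (hc : ‖c‖ < 1) : ((1 - ‖c‖ ^ 2 : ℝ) : ℂ) ≠ 0 :=
  ofReal_ne_zero.2 (by nlinarith [norm_nonneg c])

lemma shearInv_add_conj_mul (hc : ‖c‖ < 1) (w : ℂ) : shearInv c (w + conj (c * w)) = w := by
  rw [shearInv, div_eq_iff (one_sub_sq_norm_ne_zero hc)]
  push_cast
  simp only [map_add, map_mul, conj_conj]
  linear_combination -w * conj_mul' c

lemma shearInv_injective (hc : ‖c‖ < 1) : Function.Injective (shearInv c) := by
  refine Function.LeftInverse.injective (g := fun w => w + conj (c * w)) fun w => ?_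
  have hne := one_sub_sq_norm_ne_zero hc
  simp only [shearInv, map_mul, map_div₀, map_sub, conj_conj, conj_ofReal]
  rw [mul_div_assoc', ← add_div, div_eq_iff hne]
  push_cast
  linear_combination -w * conj_mul' c

lemma norm_shearInv_le (hc : ‖c‖ < 1) (w : ℂ) : ‖shearInv c w‖ ≤ ‖w‖ / (1 - ‖c‖) := by
  have hpos : 0 < 1 - ‖c‖ := sub_pos.2 hc
  have hpos' : 0 < 1 - ‖c‖ ^ 2 := by nlinarith [norm_nonneg c]
  rw [shearInv, norm_div, norm_real, Real.norm_of_nonneg hpos'.le]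
  calc ‖w - conj c * conj w‖ / (1 - ‖c‖ ^ 2) ≤ (‖w‖ + ‖c‖ * ‖w‖) / (1 - ‖c‖ ^ 2) := by
        gcongr
        simpa only [norm_mul, RCLike.norm_conj] using norm_sub_le w (conj c * conj w)
    _ = ‖w‖ / (1 - ‖c‖) := by
        rw [div_eq_div_iff hpos'.ne' hpos.ne']
        ring

end ShearInv

lemma norm_sub_dilatation_mul_sub_le {h g : ℂ → ℂ}
    (hf : SensePreservingPairOn h g (ball 0 (10 ^ 9)))
    (hexp : ∀ z ∈ ball 0 8, ‖deriv h z - exp z‖ ≤ 1 / 200) {x y : ℂ}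
    (hx : x ∈ ball 0 8) (hy : y ∈ ball 0 8) :
    ‖(g x - dilatation h g 0 * h x) - (g y - dilatation h g 0 * h y)‖ ≤
      (1 - ‖dilatation h g 0‖) / 200 * ‖x - y‖ := by
  have hsub : ball (0 : ℂ) 8 ⊆ ball 0 (10 ^ 9) := ball_subset_ball (by norm_num)
  set c := dilatation h g 0
  have hc : 0 ≤ 1 - ‖c‖ :=
    sub_nonneg.2 (hf.norm_dilatation_lt_one (mem_ball_self (by norm_num))).le
  have hdiff {F : ℂ → ℂ} (hF : DifferentiableOn ℂ F (ball 0 (10 ^ 9))) {z : ℂ}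
      (hz : z ∈ ball 0 8) : DifferentiableAt ℂ F z :=
    hF.differentiableAt (isOpen_ball.mem_nhds (hsub hz))
  refine (convex_ball 0 8).norm_image_sub_le_of_norm_hasDerivWithin_le (fun z hz =>
    ((hdiff hf.2 hz).hasDerivAt.sub ((hdiff hf.1 hz).hasDerivAt.const_mul c)).hasDerivWithinAt)
    (fun z hz => ?_) hy hx
  have hz8 : ‖z‖ ≤ 8 := (mem_ball_zero_iff.1 hz).le
  have hh' : ‖deriv h z‖ ≤ 1 / 200 + 3 ^ 8 :=
    (norm_le_norm_sub_add _ (exp z)).trans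
      (add_le_add (hexp z hz) (norm_exp_le_three_pow (mod_cast hz8)))
  have hω : ‖dilatation h g z - c‖ ≤ 4 * (1 - ‖c‖) / 10 ^ 9 * 8 := by
    have := norm_sub_le_of_mapsTo_ball (hf.differentiableOn_dilatation isOpen_ball)
      hf.mapsTo_dilatation (z := z) (by rw [sub_zero]; linarith) (by norm_num)
    rw [sub_zero] at this
    exact this.trans (by gcongr)
  calc ‖deriv g z - c * deriv h z‖ = ‖dilatation h g z - c‖ * ‖deriv h z‖ := by
        rw [← norm_mul, sub_mul, dilatation, div_mul_cancel₀ _ (hf.deriv_ne_zero (hsub hz))]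
    _ ≤ 4 * (1 - ‖c‖) / 10 ^ 9 * 8 * (1 / 200 + 3 ^ 8) := by gcongr
    _ ≤ (1 - ‖c‖) / 200 := by linarith

lemma not_injOn_of_norm_preSchwarzian_le_two {h g : ℂ → ℂ}
    (hf : SensePreservingPairOn h g (ball 0 (10 ^ 9))) (h0 : deriv h 0 = 1)
    (h1 : preSchwarzian h 0 = 1) (h2 : ∀ z ∈ ball 0 (10 ^ 9), ‖preSchwarzian h z‖ ≤ 2) :
    ¬ InjOn (fun z => h z + conj (g z)) (ball 0 (10 ^ 9)) := by
  intro hinj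
  have hsub : ball (0 : ℂ) 8 ⊆ ball 0 (10 ^ 9) := ball_subset_ball (by norm_num)
  have hexp : ∀ z ∈ ball 0 8, ‖deriv h z - exp z‖ ≤ 1 / 200 := fun z hz =>
    norm_sub_exp_le_of_norm_logDeriv_le_two (hf.1.deriv isOpen_ball) (fun _ => hf.deriv_ne_zero)
      h0 h1 h2 hz
  set c := dilatation h g 0
  have hc : ‖c‖ < 1 := hf.norm_dilatation_lt_one (mem_ball_self (by norm_num))
  have hk : InjOn (fun z => shearInv c (h z + conj (g z))) (ball 0 8) :=
    (shearInv_injective hc).comp_injOn (hinj.mono hsub)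
  refine not_injOn_of_lipschitzOnWith_sub_exp
    (lipschitzOnWith_iff_norm_sub_le.2 fun x hx y hy => ?_) hk
  set ψ : ℂ → ℂ := fun z => g z - c * h z
  have hshear (z : ℂ) : shearInv c (h z + conj (g z)) = h z + shearInv c (conj (ψ z)) := by
    conv_rhs => rw [← shearInv_add_conj_mul hc (h z), ← shearInv_add]
    congr 1
    simp only [ψ, map_sub]
    ring
  have hhexp : ‖(h x - exp x) - (h y - exp y)‖ ≤ 1 / 200 * ‖x - y‖ :=
    (convex_ball 0 8).norm_image_sub_le_of_norm_hasDerivWithin_le (fun z hz =>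
      ((hf.1.differentiableAt (isOpen_ball.mem_nhds (hsub hz))).hasDerivAt.sub
        (hasDerivAt_exp z)).hasDerivWithinAt) hexp hy hx
  have hψ : ‖shearInv c (conj (ψ x - ψ y))‖ ≤ 1 / 200 * ‖x - y‖ := by
    refine (norm_shearInv_le hc _).trans ((div_le_iff₀ (sub_pos.2 hc)).2 ?_)
    rw [RCLike.norm_conj]
    exact (norm_sub_dilatation_mul_sub_le hf hexp hx hy).trans_eq (by ring)
  have hψx : shearInv c (conj (ψ x)) =
      shearInv c (conj (ψ x - ψ y)) + shearInv c (conj (ψ y)) := by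
    rw [← shearInv_add, ← map_add, sub_add_cancel]
  calc ‖shearInv c (h x + conj (g x)) - exp x - (shearInv c (h y + conj (g y)) - exp y)‖
      = ‖((h x - exp x) - (h y - exp y)) + shearInv c (conj (ψ x - ψ y))‖ := by
        rw [hshear, hshear, hψx]
        congr 1
        ring
    _ ≤ 1 / 200 * ‖x - y‖ + 1 / 200 * ‖x - y‖ := norm_add_le_of_le hhexp hψ
    _ = (1 / 100 : ℝ≥0) * ‖x - y‖ := by push_cast; ring

lemma deriv_const_mul_comp_affine (F : ℂ → ℂ) (a b c : ℂ) :
    deriv (fun z => b * F (c + a * z)) = fun z => b * a * deriv F (c + a * z) := by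
  funext z
  rw [deriv_const_mul_field, deriv_comp_mul_left a (fun w => F (c + w)) z, deriv_comp_const_add,
    smul_eq_mul, mul_assoc]

lemma preSchwarzian_const_mul_comp_affine (F : ℂ → ℂ) {a b : ℂ} (ha : a ≠ 0) (hb : b ≠ 0)
    (c z : ℂ) :
    preSchwarzian (fun z => b * F (c + a * z)) z = a * preSchwarzian F (c + a * z) := by
  rw [preSchwarzian, logDeriv_apply, deriv_const_mul_comp_affine,
    deriv_const_mul_comp_affine (deriv F), preSchwarzian, logDeriv_apply]
  field_simp

lemma SensePreservingPairOn.const_mul_comp_affine {h g : ℂ → ℂ} {s t : Set ℂ}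
    (hf : SensePreservingPairOn h g s) {a b c : ℂ} (ha : a ≠ 0) (hb : b ≠ 0)
    (hmaps : MapsTo (fun z => c + a * z) t s) :
    SensePreservingPairOn (fun z => b * h (c + a * z)) (fun z => conj b * g (c + a * z)) t where
  differentiableOn_left := (hf.1.comp (by fun_prop) hmaps).const_mul b
  differentiableOn_right := (hf.2.comp (by fun_prop) hmaps).const_mul (conj b)
  norm_deriv_lt z hz := by
    simp only [deriv_const_mul_comp_affine, norm_mul, RCLike.norm_conj]
    have := mul_pos (norm_pos_iff.2 hb) (norm_pos_iff.2 ha)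
    exact mul_lt_mul_of_pos_left (hf.norm_deriv_lt _ (hmaps hz)) this

lemma mul_norm_preSchwarzian_le_of_forall_le {h g : ℂ → ℂ} {c : ℂ} {r : ℝ}
    (hf : SensePreservingPairOn h g (ball c r))
    (hinj : InjOn (fun z => h z + conj (g z)) (ball c r))
    (hle : ∀ z ∈ ball c r, ‖preSchwarzian h z‖ ≤ 2 * ‖preSchwarzian h c‖) :
    r * ‖preSchwarzian h c‖ ≤ 10 ^ 9 := by
  by_contra! hlarge
  set α := preSchwarzian h c
  have hα : α ≠ 0 := by
    rintro h
    norm_num [h] at hlarge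
  have hα' : 0 < ‖α‖ := norm_pos_iff.2 hα
  have hr : 0 < r := pos_of_mul_pos_left (hlarge.trans' (by norm_num)) hα'.le
  have hhc : deriv h c ≠ 0 := hf.deriv_ne_zero (mem_ball_self hr)
  have hb : α / deriv h c ≠ 0 := div_ne_zero hα hhc
  have hmaps : MapsTo (fun z => c + α⁻¹ * z) (ball 0 (10 ^ 9)) (ball c r) := fun z hz => by
    rw [mem_ball, dist_eq_norm, add_sub_cancel_left, norm_mul, norm_inv, inv_mul_lt_iff₀ hα',
      mul_comm]
    exact (mem_ball_zero_iff.1 hz).trans hlarge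
  have hP := preSchwarzian_const_mul_comp_affine h (inv_ne_zero hα) hb c
  refine not_injOn_of_norm_preSchwarzian_le_two
    (hf.const_mul_comp_affine (inv_ne_zero hα) hb hmaps) ?_ ?_ (fun z hz => ?_) ?_
  · simp only [deriv_const_mul_comp_affine, mul_zero, add_zero]
    field_simp
  · rw [hP, mul_zero, add_zero, inv_mul_cancel₀ hα]
  · rw [hP, norm_mul, norm_inv, inv_mul_le_iff₀ hα', mul_comm ‖α‖]
    exact hle _ (hmaps hz)
  · have haffine : Function.Injective fun z => c + α⁻¹ * z :=
      (add_right_injective c).comp (mul_right_injective₀ (inv_ne_zero hα))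
    have := (mul_right_injective₀ hb).comp_injOn (hinj.comp haffine.injOn hmaps)
    simpa only [map_mul, conj_conj, ← mul_add, Function.comp_def] using this

lemma mul_norm_preSchwarzian_le_of_injOn {h g : ℂ → ℂ} {c : ℂ} {r : ℝ}
    (hf : SensePreservingPairOn h g (ball c r))
    (hinj : InjOn (fun z => h z + conj (g z)) (ball c r)) (hr : 0 < r) :
    r * ‖preSchwarzian h c‖ ≤ 4 * 10 ^ 9 := by
  have hcont : ContinuousOn (fun z => ‖preSchwarzian h z‖) (closedBall c (3 * r / 4)) :=
    (hf.differentiableOn_preSchwarzian isOpen_ball).continuousOn.norm.mono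
      (closedBall_subset_ball (by linarith))
  have : CompleteSpace (closedBall c (3 * r / 4)) := isClosed_closedBall.completeSpace_coe
  obtain ⟨δ, hδ, ⟨a, ha⟩, hδr, hac, hmul, hle⟩ := hofer
    (⟨c, mem_closedBall_self (by positivity)⟩ : closedBall c (3 * r / 4)) (r / 4) (by positivity)
    (continuousOn_iff_continuous_domRestrict.1 hcont) (fun _ => norm_nonneg _)
  simp only [Subtype.dist_eq, domRestrict_apply] at hac hmul hle
  have hsub' : closedBall a δ ⊆ closedBall c (3 * r / 4) :=
    closedBall_subset_closedBall' (by linarith)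
  have hsub : ball a δ ⊆ ball c r :=
    (ball_subset_closedBall.trans hsub').trans (closedBall_subset_ball (by linarith))
  have := mul_norm_preSchwarzian_le_of_forall_le (hf.mono hsub) (hinj.mono hsub) fun z hz =>
    hle ⟨z, hsub' (ball_subset_closedBall hz)⟩ (mem_ball'.1 hz).le
  linarith

lemma ball_subset_hyperbolicDisk {a : ℂ} (ha : ‖a‖ < 1) (ρ : ℝ) :
    ball a (Real.tanh ρ * (1 - ‖a‖)) ⊆ hyperbolicDisk a ρ := by
  intro z hz
  have hza : ‖z - a‖ < Real.tanh ρ * (1 - ‖a‖) := by simpa [dist_eq_norm] using hz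
  have hρ : 0 < Real.tanh ρ :=
    pos_of_mul_pos_left ((norm_nonneg _).trans_lt hza) (sub_pos.2 ha).le
  have hz1 : ‖z‖ < 1 := by
    nlinarith [norm_le_norm_sub_add z a, Real.tanh_lt_one ρ]
  have hden : 1 - ‖a‖ ≤ ‖1 - conj a * z‖ := by
    have := norm_sub_norm_le 1 (conj a * z)
    rw [norm_one, norm_mul, RCLike.norm_conj] at this
    nlinarith [norm_nonneg a]
  refine ⟨mem_ball_zero_iff.2 hz1, ?_⟩
  rw [norm_div, div_lt_iff₀ ((sub_pos.2 ha).trans_le hden)]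
  exact hza.trans_le (by gcongr)

lemma IsULU.exists_norm_preSchwarzian_le {F H G : ℂ → ℂ}
    (hulu : IsULU F) (hf : SensePreservingPairOn H G (ball 0 1))
    (hF : EqOn F (fun z => H z + conj (G z)) (ball 0 1)) :
    ∃ C, ∀ z ∈ ball 0 1, (1 - ‖z‖) * ‖preSchwarzian H z‖ ≤ C := by
  obtain ⟨-, ρ, hρ, hinj⟩ := hulu
  have ht : 0 < Real.tanh ρ := by
    rw [Real.tanh_eq_sinh_div_cosh]
    exact div_pos (Real.sinh_pos_iff.2 hρ) (Real.cosh_pos ρ)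
  refine ⟨4 * 10 ^ 9 / Real.tanh ρ, fun z hz => ?_⟩
  have hz1 : ‖z‖ < 1 := mem_ball_zero_iff.1 hz
  have hsub := ball_subset_hyperbolicDisk hz1 ρ
  have hsub' : ball z (Real.tanh ρ * (1 - ‖z‖)) ⊆ ball 0 1 := fun w hw => (hsub hw).1
  have := mul_norm_preSchwarzian_le_of_injOn (hf.mono hsub')
    (((hinj z hz).mono hsub).congr (hF.mono hsub')) (mul_pos ht (sub_pos.2 hz1))
  rw [le_div_iff₀' ht]
  linarith

section Combination

variable {H G : ℂ → ℂ} {s : Set ℂ} {ε : ℂ}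

lemma SensePreservingPairOn.deriv_add_mul_deriv_eq (hf : SensePreservingPairOn H G s) {z : ℂ}
    (hz : z ∈ s) :
    deriv H z + ε * deriv G z = deriv H z * (1 + ε * dilatation H G z) := by
  rw [dilatation, mul_add, mul_one, mul_left_comm, mul_div_cancel₀ _ (hf.deriv_ne_zero hz)]

lemma one_sub_norm_le_norm_one_add_mul (hε : ‖ε‖ ≤ 1) (w : ℂ) : 1 - ‖w‖ ≤ ‖1 + ε * w‖ := by
  have := norm_sub_norm_le 1 (-(ε * w))
  rw [norm_one, norm_neg, norm_mul, sub_neg_eq_add] at this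
  nlinarith [norm_nonneg w]

lemma SensePreservingPairOn.one_add_mul_dilatation_ne_zero (hf : SensePreservingPairOn H G s)
    (hε : ‖ε‖ ≤ 1) {z : ℂ} (hz : z ∈ s) : 1 + ε * dilatation H G z ≠ 0 :=
  norm_pos_iff.1 <| (sub_pos.2 (hf.norm_dilatation_lt_one hz)).trans_le
    (one_sub_norm_le_norm_one_add_mul hε _)

lemma SensePreservingPairOn.deriv_add_mul_deriv_ne_zero (hf : SensePreservingPairOn H G s)
    (hε : ‖ε‖ ≤ 1) {z : ℂ} (hz : z ∈ s) : deriv H z + ε * deriv G z ≠ 0 := by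
  rw [hf.deriv_add_mul_deriv_eq hz]
  exact mul_ne_zero (hf.deriv_ne_zero hz) (hf.one_add_mul_dilatation_ne_zero hε hz)

lemma SensePreservingPairOn.logDeriv_deriv_add_mul_deriv (hf : SensePreservingPairOn H G s)
    (hs : IsOpen s) (hε : ‖ε‖ ≤ 1) {z : ℂ} (hz : z ∈ s) :
    logDeriv (fun z => deriv H z + ε * deriv G z) z =
      preSchwarzian H z + ε * deriv (dilatation H G) z / (1 + ε * dilatation H G z) := by
  have hnhds : s ∈ 𝓝 z := hs.mem_nhds hz
  have hω := ((hf.differentiableOn_dilatation hs).differentiableAt hnhds).const_mul ε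
  have heq : (fun z => deriv H z + ε * deriv G z) =ᶠ[𝓝 z]
      fun z => deriv H z * (1 + ε * dilatation H G z) :=
    eventually_of_mem hnhds fun w hw => hf.deriv_add_mul_deriv_eq hw
  rw [(logDeriv_congr_nhds heq).eq_of_nhds, logDeriv_mul z (hf.deriv_ne_zero hz)
    (hf.one_add_mul_dilatation_ne_zero hε hz)
    ((hf.differentiableOn_left.deriv hs).differentiableAt hnhds) (hω.const_add 1),
    logDeriv_apply (fun z => 1 + ε * dilatation H G z), deriv_const_add, deriv_const_mul_field]
  rfl

lemma SensePreservingPairOn.mul_norm_logDeriv_sub_le (hf : SensePreservingPairOn H G (ball 0 1))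
    (hε : ‖ε‖ ≤ 1) {z : ℂ} (hz : z ∈ ball 0 1) :
    (1 - ‖z‖) *
      ‖logDeriv (fun z => deriv H z + ε * deriv G z) z - preSchwarzian H z‖ ≤ 4 := by
  have hz1 : 0 < 1 - ‖z‖ := sub_pos.2 (mem_ball_zero_iff.1 hz)
  have hω1 : 0 < 1 - ‖dilatation H G z‖ :=
    sub_pos.2 (hf.norm_dilatation_lt_one hz)
  have hsub : ball z (1 - ‖z‖) ⊆ ball 0 1 := ball_subset_ball' (by simp)
  have hω' := norm_deriv_le_of_mapsTo_ball
    ((hf.differentiableOn_dilatation isOpen_ball).mono hsub)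
    (hf.mapsTo_dilatation.mono_left hsub) hz1
  have hden := one_sub_norm_le_norm_one_add_mul hε (dilatation H G z)
  rw [hf.logDeriv_deriv_add_mul_deriv isOpen_ball hε hz, add_sub_cancel_left, norm_div, norm_mul]
  calc (1 - ‖z‖) * (‖ε‖ * ‖deriv (dilatation H G) z‖ / ‖1 + ε * dilatation H G z‖)
      ≤ (1 - ‖z‖) * (1 * (4 * (1 - ‖dilatation H G z‖) / (1 - ‖z‖)) /
          (1 - ‖dilatation H G z‖)) := by gcongr
    _ = 4 := by field_simp

end Combination

lemma add_conj_mem_blochType_one {h g ω : ℂ → ℂ} (hh : AnalyticOnNhd ℂ h (ball 0 1))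
    (hg : AnalyticOnNhd ℂ g (ball 0 1)) {M C : ℝ} (hω : ∀ z ∈ ball 0 1, ‖ω z‖ ≤ M)
    (hgω : ∀ z ∈ ball 0 1, deriv g z = ω z * deriv h z)
    (hC : ∀ z ∈ ball 0 1, (1 - ‖z‖) * ‖deriv h z‖ ≤ C) :
    (fun z => h z + conj (g z)) ∈ blochType 1 := by
  refine ⟨isHarmonicMapping_add_conj hh hg, 2 * ((1 + M) * C), ?_⟩
  rintro _ ⟨z, hz, rfl⟩
  have hz1 : ‖z‖ < 1 := mem_ball_zero_iff.1 hz
  have hM : 0 ≤ M := (norm_nonneg _).trans (hω z hz)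
  have hjac : |jacobian (fun z => h z + conj (g z)) z| ≤ ((1 + M) * ‖deriv h z‖) ^ 2 := by
    have hgM : ‖deriv g z‖ ≤ M * ‖deriv h z‖ := by
      rw [hgω z hz, norm_mul]
      gcongr
      exact hω z hz
    rw [jacobian_add_conj (hh z hz).differentiableAt (hg z hz).differentiableAt, abs_le]
    constructor <;> nlinarith [norm_nonneg (deriv g z), norm_nonneg (deriv h z),
      mul_nonneg hM (norm_nonneg (deriv h z))]
  have hweight : 1 - ‖z‖ ^ 2 ≤ 2 * (1 - ‖z‖) := by nlinarith [sq_nonneg (1 - ‖z‖)]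
  calc (1 - ‖z‖ ^ 2) ^ (1 : ℝ) * √|jacobian (fun z => h z + conj (g z)) z|
      ≤ 2 * (1 - ‖z‖) * ((1 + M) * ‖deriv h z‖) := by
        rw [Real.rpow_one]
        gcongr
        exact (Real.sqrt_le_left (by positivity)).2 hjac
    _ = 2 * ((1 + M) * ((1 - ‖z‖) * ‖deriv h z‖)) := by ring
    _ ≤ 2 * ((1 + M) * C) := by gcongr; exact hC z hz

end HarmonicBloch

theorem theorem1 (F H G : ℂ → ℂ)
    (hH : AnalyticOnNhd ℂ H (ball (0 : ℂ) 1))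
    (hG : AnalyticOnNhd ℂ G (ball (0 : ℂ) 1))
    (hF : ∀ z ∈ ball (0 : ℂ) 1, F z = H z + conj (G z))
    (hsp : HarmonicBloch.SensePreserving F)
    (hulu : HarmonicBloch.IsULU F)
    (ε : ℂ) (hε : ‖ε‖ ≤ 1) :
    (∃ h : ℂ → ℂ, AnalyticOnNhd ℂ h (ball (0 : ℂ) 1) ∧
      ∀ z ∈ ball (0 : ℂ) 1, exp (h z) = deriv H z + ε * deriv G z) ∧
    ∀ h g ω : ℂ → ℂ,
      AnalyticOnNhd ℂ h (ball (0 : ℂ) 1) →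
      AnalyticOnNhd ℂ g (ball (0 : ℂ) 1) →
      (∀ z ∈ ball (0 : ℂ) 1, exp (h z) = deriv H z + ε * deriv G z) →
      (∀ z ∈ ball (0 : ℂ) 1, deriv g z = ω z * deriv h z) →
      (∃ M : ℝ, ∀ z ∈ ball (0 : ℂ) 1, ‖ω z‖ ≤ M) →
      (fun z => h z + conj (g z)) ∈ HarmonicBloch.blochType 1 := by
  have hf : HarmonicBloch.SensePreservingPairOn H G (ball 0 1) :=
    ⟨hH.differentiableOn, hG.differentiableOn,
      fun _ => hsp.norm_deriv_lt hH.differentiableOn hG.differentiableOn hF⟩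
  obtain ⟨C, hC⟩ := hulu.exists_norm_preSchwarzian_le hf hF
  have hdiff : DifferentiableOn ℂ (fun z => deriv H z + ε * deriv G z) (ball 0 1) :=
    (hf.1.deriv isOpen_ball).add ((hf.2.deriv isOpen_ball).const_mul ε)
  refine ⟨HarmonicBloch.exists_analyticOnNhd_exp_eq hdiff
    fun _ => hf.deriv_add_mul_deriv_ne_zero hε, ?_⟩
  rintro h g ω hh hg hexp hgω ⟨M, hM⟩
  refine HarmonicBloch.add_conj_mem_blochType_one hh hg hM hgω (C := 4 + C) fun z hz => ?_
  have hz1 : 0 ≤ 1 - ‖z‖ := (sub_pos.2 (mem_ball_zero_iff.1 hz)).le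
  rw [HarmonicBloch.deriv_eq_logDeriv_of_exp_eq isOpen_ball hh.differentiableOn hexp hz]
  calc _ ≤ (1 - ‖z‖) * (‖logDeriv (fun z => deriv H z + ε * deriv G z) z -
          HarmonicBloch.preSchwarzian H z‖ + ‖HarmonicBloch.preSchwarzian H z‖) := by
        gcongr
        exact norm_le_norm_sub_add _ _
    _ ≤ 4 + C := by
        rw [mul_add]
        exact add_le_add (hf.mul_norm_logDeriv_sub_le hε hz) (hC z hz)
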